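/- Let $k$ be a number field with algebraic closure $\bar k$, let $W\subseteq\mathbb P^n$ and $V\subseteq\mathbb P^m$ be projective varieties over $k$ (possibly reducible; that is, zero loci of homogeneous polynomials with coefficients in $k$), and let $\pi\colon W\to V$ be a dominant morphism defined over $k$. Assume that there exists an embedding $\varphi\colon k\to\mathbb C$ such that the induced map $\pi_{\mathbb C}\colon W(\mathbb C)\to V(\mathbb C)$, where $W,V,\pi$ are viewed over $\mathbb C$ through $\varphi$ and the sets of complex points carry the complex topology, is a topological cover: it is continuous and surjective, and each point of $V(\mathbb C)$ has an open neighborhood $U$ such that $\pi_{\mathbb C}^{-1}(U)$ is homeomorphic, over $U$, to $U\times F$ for some discrete space $F$. Then there exists a finite set $S$ of places of $\mathbb Q$ such that, for all points $P\in V(\bar k)$ and $Q\in W(\bar k)$ with $\pi(Q)=P$, the extension $k(Q)/k(P)$ is ramified at most above places of $k(P)$ lying above $S$. Here $k(P)$ and $k(Q)$ are the fields generated over $k$ by the ratios of the homogeneous coordinates of $P$ and of $Q$. -/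

import Mathlib

open MvPolynomial
open scoped LinearAlgebra.Projectivization

/-- The quotient topology on the projective space `ℙ K E` of a topological vector space `E`.
For `E = Fin (n + 1) → ℂ` this is the classical (complex) topology on `ℙⁿ(ℂ)`. -/
instance Projectivization.instQuotientTopology (K E : Type*) [DivisionRing K] [AddCommGroup E]
    [Module K E] [TopologicalSpace E] : TopologicalSpace (ℙ K E) :=
  TopologicalSpace.coinduced (fun v : {v : E // v ≠ 0} => Projectivization.mk' K v) inferInstance

/-- The value of a form of degree `d` at a rescaled vector. -/
theorem eval₂_smul_of_isHomogeneous {ι k K : Type*} [CommSemiring k]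
    [CommSemiring K] {F : MvPolynomial ι k} {d : ℕ} (hF : F.IsHomogeneous d) (σ : k →+* K)
    (c : K) (x : ι → K) : eval₂ σ (c • x) F = c ^ d * eval₂ σ x F := by
  rw [eval₂_eq, eval₂_eq, Finset.mul_sum]
  refine Finset.sum_congr rfl fun m hm => ?_
  have hd : ∑ i ∈ m.support, m i = d := by
    rw [← hF (mem_support_iff.mp hm)]
    simp [Finsupp.weight_apply, Finsupp.sum]
  simp only [Pi.smul_apply, smul_eq_mul, mul_pow, Finset.prod_mul_distrib]
  rw [Finset.prod_pow_eq_pow_sum, hd]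
  ring

/-- Consequence of the Nullstellensatz: a polynomial implication between polynomials with
coefficients in `k` that holds over the algebraic closure of `k` holds over every extension. -/
theorem MvPolynomial.eval₂_eq_zero_of_algebraicClosure {ι k K : Type*} [Finite ι] [Field k]
    [Field K] (σ : k →+* K) (T : Set (MvPolynomial ι k)) (G : MvPolynomial ι k)
    (h : ∀ x : ι → AlgebraicClosure k,
      (∀ F ∈ T, eval₂ (algebraMap k (AlgebraicClosure k)) x F = 0) →
        eval₂ (algebraMap k (AlgebraicClosure k)) x G = 0)
    (x : ι → K) (hx : ∀ F ∈ T, eval₂ σ x F = 0) : eval₂ σ x G = 0 := by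
  have hG : G ∈ (Ideal.span T).radical := by
    rw [← vanishingIdeal_zeroLocus_eq_radical (K := AlgebraicClosure k), mem_vanishingIdeal_iff]
    intro y hy
    rw [zeroLocus_span] at hy
    exact h y hy
  obtain ⟨N, hN⟩ := hG
  have hle : Ideal.span T ≤ RingHom.ker (eval₂Hom σ x) :=
    Ideal.span_le.mpr fun F hF => hx F hF
  have h0 : eval₂Hom σ x (G ^ N) = 0 := hle hN
  rw [map_pow] at h0
  exact eq_zero_of_pow_eq_zero h0

/-- A (possibly reducible) projective variety over the field `k`, embedded in `ℙⁿ`: it is given by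
a set of homogeneous equations with coefficients in `k`. -/
structure ProjectiveVariety (k : Type*) [Field k] (n : ℕ) where
  /-- the equations -/
  equations : Set (MvPolynomial (Fin (n + 1)) k)
  homogeneous : ∀ F ∈ equations, ∃ d : ℕ, F.IsHomogeneous d

namespace ProjectiveVariety

/-- The vector `x` of homogeneous coordinates in the extension `σ : k →+* K` of `k` satisfies the
equations of `V`. -/
def VanishesAt {k K : Type*} [Field k] [Field K] {n : ℕ} (V : ProjectiveVariety k n)
    (σ : k →+* K) (x : Fin (n + 1) → K) : Prop :=
  ∀ F ∈ V.equations, eval₂ σ x F = 0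

/-- The set `V(K)` of points of `V` in the extension `σ : k →+* K` of `k`. -/
def points {k K : Type*} [Field k] [Field K] {n : ℕ} (V : ProjectiveVariety k n)
    (σ : k →+* K) : Set (ℙ K (Fin (n + 1) → K)) :=
  {P | V.VanishesAt σ P.rep}

theorem VanishesAt.smul {k K : Type*} [Field k] [Field K] {n : ℕ} {V : ProjectiveVariety k n}
    {σ : k →+* K} {x : Fin (n + 1) → K} (h : V.VanishesAt σ x) (c : K) :
    V.VanishesAt σ (c • x) := by
  intro F hF
  obtain ⟨d, hd⟩ := V.homogeneous F hF
  rw [eval₂_smul_of_isHomogeneous hd, h F hF, mul_zero]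

/-- Membership in `V(K)` can be tested on any vector of homogeneous coordinates. -/
theorem mk_mem_points {k K : Type*} [Field k] [Field K] {n : ℕ} (V : ProjectiveVariety k n)
    (σ : k →+* K) (x : Fin (n + 1) → K) (hx : x ≠ 0) :
    Projectivization.mk K x hx ∈ V.points σ ↔ V.VanishesAt σ x := by
  obtain ⟨a, ha⟩ := Projectivization.exists_smul_eq_mk_rep K x hx
  constructor
  · intro h
    have h' : V.VanishesAt σ (a • x) := by rw [ha]; exact h
    have h2 := h'.smul ((a⁻¹ : Kˣ) : K)
    rwa [← Units.smul_def, inv_smul_smul] at h2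
  · intro h
    change V.VanishesAt σ _
    rw [← ha, Units.smul_def]
    exact h.smul _

/-- A morphism `W → V` over `k` of projective varieties `W ⊆ ℙⁿ`, `V ⊆ ℙᵐ`. It is given by
`(m + 1)`-tuples of forms of the same degree over `k`, such that at each geometric point of `W`
one of the tuples does not vanish, any two tuples define the same point of `ℙᵐ` wherever neither
of them vanishes on `W`, and this point lies in `V`. -/
structure Morphism {k : Type*} [Field k] {n m : ℕ} (W : ProjectiveVariety k n)
    (V : ProjectiveVariety k m) where
  /-- the local representatives -/
  reps : Set (Fin (m + 1) → MvPolynomial (Fin (n + 1)) k)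
  homogeneous : ∀ F ∈ reps, ∃ d : ℕ, ∀ j, (F j).IsHomogeneous d
  cover : ∀ x : Fin (n + 1) → AlgebraicClosure k, x ≠ 0 →
    W.VanishesAt (algebraMap k (AlgebraicClosure k)) x →
      ∃ F ∈ reps, ∃ j, eval₂ (algebraMap k (AlgebraicClosure k)) x (F j) ≠ 0
  compat : ∀ F ∈ reps, ∀ G ∈ reps, ∀ x : Fin (n + 1) → AlgebraicClosure k, x ≠ 0 →
    W.VanishesAt (algebraMap k (AlgebraicClosure k)) x → ∀ i j,
      eval₂ (algebraMap k (AlgebraicClosure k)) x (F i) *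
          eval₂ (algebraMap k (AlgebraicClosure k)) x (G j) =
        eval₂ (algebraMap k (AlgebraicClosure k)) x (F j) *
          eval₂ (algebraMap k (AlgebraicClosure k)) x (G i)
  mapsTo : ∀ F ∈ reps, ∀ x : Fin (n + 1) → AlgebraicClosure k, x ≠ 0 →
    W.VanishesAt (algebraMap k (AlgebraicClosure k)) x →
      (∃ j, eval₂ (algebraMap k (AlgebraicClosure k)) x (F j) ≠ 0) →
        V.VanishesAt (algebraMap k (AlgebraicClosure k))
          (fun j => eval₂ (algebraMap k (AlgebraicClosure k)) x (F j))

namespace Morphism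

variable {k K : Type*} [Field k] [Field K] {n m : ℕ} {W : ProjectiveVariety k n}
  {V : ProjectiveVariety k m}

theorem exists_rep (π : W.Morphism V) (σ : k →+* K) (x : Fin (n + 1) → K) (hx : x ≠ 0)
    (hW : W.VanishesAt σ x) : ∃ F ∈ π.reps, (fun j => eval₂ σ x (F j)) ≠ 0 := by
  by_contra hcon
  push Not at hcon
  apply hx
  funext l
  have := eval₂_eq_zero_of_algebraicClosure σ
    (W.equations ∪ {G | ∃ F ∈ π.reps, ∃ j, F j = G}) (X l) ?_ x ?_
  · simpa using this
  · intro y hy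
    by_cases hy0 : y = 0
    · simp [hy0]
    · obtain ⟨F, hF, j, hj⟩ := π.cover y hy0 fun G hG => hy G (Or.inl hG)
      exact absurd (hy (F j) (Or.inr ⟨F, hF, j, rfl⟩)) hj
  · rintro G (hG | ⟨F, hF, j, rfl⟩)
    · exact hW G hG
    · exact congrFun (hcon F hF) j

theorem compat_of_hom (π : W.Morphism V) (σ : k →+* K) (x : Fin (n + 1) → K) (hx : x ≠ 0)
    (hW : W.VanishesAt σ x) {F G : Fin (m + 1) → MvPolynomial (Fin (n + 1)) k}
    (hF : F ∈ π.reps) (hG : G ∈ π.reps) (i j : Fin (m + 1)) :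
    eval₂ σ x (F i) * eval₂ σ x (G j) = eval₂ σ x (F j) * eval₂ σ x (G i) := by
  obtain ⟨l, hl⟩ := Function.ne_iff.mp hx
  have := eval₂_eq_zero_of_algebraicClosure σ W.equations
    (X l * (F i * G j - F j * G i)) ?_ x hW
  · simp only [eval₂_mul, eval₂_X, eval₂_sub] at this
    exact sub_eq_zero.mp ((mul_eq_zero.mp this).resolve_left hl)
  · intro y hy
    by_cases hy0 : y = 0
    · simp [hy0]
    · simp only [eval₂_mul, eval₂_X, eval₂_sub]
      rw [π.compat F hF G hG y hy0 hy i j, sub_self, mul_zero]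

theorem mapsTo_of_hom (π : W.Morphism V) (σ : k →+* K) (x : Fin (n + 1) → K) (hx : x ≠ 0)
    (hW : W.VanishesAt σ x) {F : Fin (m + 1) → MvPolynomial (Fin (n + 1)) k}
    (hF : F ∈ π.reps) (hne : (fun j => eval₂ σ x (F j)) ≠ 0) :
    V.VanishesAt σ (fun j => eval₂ σ x (F j)) := by
  intro E hE
  obtain ⟨l, hl⟩ := Function.ne_iff.mp hx
  obtain ⟨j, hj⟩ := Function.ne_iff.mp hne
  have := eval₂_eq_zero_of_algebraicClosure σ W.equations (X l * (F j * bind₁ F E)) ?_ x hW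
  · simp only [eval₂_mul, eval₂_X] at this
    have h2 := (mul_eq_zero.mp ((mul_eq_zero.mp this).resolve_left hl)).resolve_left hj
    exact (eval₂Hom_bind₁ σ x F E).symm.trans h2
  · intro y hy
    by_cases hy0 : y = 0
    · simp [hy0]
    · simp only [eval₂_mul, eval₂_X]
      by_cases hj0 : eval₂ (algebraMap k (AlgebraicClosure k)) y (F j) = 0
      · rw [hj0, zero_mul, mul_zero]
      · have h3 := π.mapsTo F hF y hy0 hy ⟨j, hj0⟩ E hE
        have h4 : eval₂ (algebraMap k (AlgebraicClosure k)) y (bind₁ F E) = 0 :=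
          (eval₂Hom_bind₁ (algebraMap k (AlgebraicClosure k)) y F E).trans h3
        rw [h4, mul_zero, mul_zero]

/-- The map `W(K) → V(K)` induced by the morphism `π` on the points in the extension
`σ : k →+* K` of `k`: the image of `Q` is `(F₀(Q) : … : Fₘ(Q))`, for any of the representatives `F`
of `π` that does not vanish at `Q`. -/
noncomputable def map (π : W.Morphism V) (σ : k →+* K) (Q : W.points σ) : V.points σ :=
  ⟨Projectivization.mk K
      (fun j => eval₂ σ Q.1.rep ((π.exists_rep σ Q.1.rep Q.1.rep_nonzero Q.2).choose j))
      (π.exists_rep σ Q.1.rep Q.1.rep_nonzero Q.2).choose_spec.2,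
    (V.mk_mem_points σ _ _).mpr (π.mapsTo_of_hom σ Q.1.rep Q.1.rep_nonzero Q.2
      (π.exists_rep σ Q.1.rep Q.1.rep_nonzero Q.2).choose_spec.1
      (π.exists_rep σ Q.1.rep Q.1.rep_nonzero Q.2).choose_spec.2)⟩

/-- The value of `π` does not depend on the homogeneous coordinates or on the representative. -/
theorem map_eq_mk (π : W.Morphism V) (σ : k →+* K) (Q : W.points σ) (x : Fin (n + 1) → K)
    (hx : x ≠ 0) (hQ : (Q : ℙ K (Fin (n + 1) → K)) = Projectivization.mk K x hx)
    (F : Fin (m + 1) → MvPolynomial (Fin (n + 1)) k) (hF : F ∈ π.reps)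
    (hne : (fun j => eval₂ σ x (F j)) ≠ 0) :
    (π.map σ Q : ℙ K (Fin (m + 1) → K)) =
      Projectivization.mk K (fun j => eval₂ σ x (F j)) hne := by
  obtain ⟨d, hd⟩ := π.homogeneous F hF
  obtain ⟨a, ha⟩ := Projectivization.exists_smul_eq_mk_rep K x hx
  rw [← hQ, Units.smul_def] at ha
  have hspec := (π.exists_rep σ Q.1.rep Q.1.rep_nonzero Q.2).choose_spec
  have hFQ : ∀ j, eval₂ σ Q.1.rep (F j) = (a : K) ^ d * eval₂ σ x (F j) := by
    intro j
    rw [← ha, eval₂_smul_of_isHomogeneous (hd j)]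
  have ha0 : (a : K) ^ d ≠ 0 := pow_ne_zero _ a.ne_zero
  change Projectivization.mk K _ _ = _
  obtain ⟨j, hj⟩ := Function.ne_iff.mp hne
  have hj' : eval₂ σ x (F j) ≠ 0 := hj
  rw [Projectivization.mk_eq_mk_iff']
  refine ⟨eval₂ σ Q.1.rep ((π.exists_rep σ Q.1.rep Q.1.rep_nonzero Q.2).choose j) /
    eval₂ σ x (F j), ?_⟩
  funext i
  have h := π.compat_of_hom σ Q.1.rep Q.1.rep_nonzero Q.2 hF hspec.1 i j
  rw [hFQ, hFQ, mul_assoc, mul_assoc] at h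
  have h' := mul_left_cancel₀ ha0 h
  simp only [Pi.smul_apply, smul_eq_mul]
  rw [div_mul_eq_mul_div, div_eq_iff hj', mul_comm]
  rw [h', mul_comm]

/-- `π : W → V` is dominant: its image is Zariski dense, that is, each form over `k` that vanishes
on the image of `π` vanishes on `V`. -/
def IsDominant (π : W.Morphism V) : Prop :=
  ∀ (d : ℕ) (G : MvPolynomial (Fin (m + 1)) k), G.IsHomogeneous d →
    (∀ Q : W.points (algebraMap k (AlgebraicClosure k)),
      eval₂ (algebraMap k (AlgebraicClosure k))
        (π.map (algebraMap k (AlgebraicClosure k)) Q).1.rep G = 0) →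
    ∀ P : V.points (algebraMap k (AlgebraicClosure k)),
      eval₂ (algebraMap k (AlgebraicClosure k)) P.1.rep G = 0

end Morphism

end ProjectiveVariety

/-- A topological cover: a surjective covering map (continuity is part of the latter). -/
def IsTopologicalCover {X Y : Type*} [TopologicalSpace X] [TopologicalSpace Y] (f : X → Y) :
    Prop :=
  Function.Surjective f ∧ IsCoveringMap f

/-- The field of definition `k(P)` of a point `P` of projective space over the algebraic closure
of `k`: the field generated over `k` by the ratios of the homogeneous coordinates of `P`. -/
noncomputable def fieldOfPoint {k : Type*} [Field k] {n : ℕ}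
    (P : ℙ (AlgebraicClosure k) (Fin (n + 1) → AlgebraicClosure k)) :
    IntermediateField k (AlgebraicClosure k) :=
  IntermediateField.adjoin k {z | ∃ i j, P.rep j ≠ 0 ∧ z = P.rep i / P.rep j}

/-- `k(P)` can be computed with any vector of homogeneous coordinates. -/
theorem fieldOfPoint_mk {k : Type*} [Field k] {n : ℕ} (x : Fin (n + 1) → AlgebraicClosure k)
    (hx : x ≠ 0) : fieldOfPoint (Projectivization.mk (AlgebraicClosure k) x hx) =
      IntermediateField.adjoin k {z | ∃ i j, x j ≠ 0 ∧ z = x i / x j} := by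
  obtain ⟨a, ha⟩ := Projectivization.exists_smul_eq_mk_rep (AlgebraicClosure k) x hx
  unfold fieldOfPoint
  congr 1
  ext z
  simp only [← ha, Set.mem_ofPred_eq, Pi.smul_apply, Units.smul_def, smul_eq_mul]
  refine exists_congr fun i => exists_congr fun j => ?_
  rw [mul_div_mul_left _ _ a.ne_zero]
  simp

/-- `k(π(Q)) ⊆ k(Q)`. -/
theorem ProjectiveVariety.Morphism.fieldOfPoint_map_le {k : Type*} [Field k] {n m : ℕ}
    {W : ProjectiveVariety k n} {V : ProjectiveVariety k m} (π : W.Morphism V)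
    (Q : W.points (algebraMap k (AlgebraicClosure k))) :
    fieldOfPoint (π.map (algebraMap k (AlgebraicClosure k)) Q).1 ≤ fieldOfPoint Q.1 := by
  obtain ⟨j₀, hj₀⟩ := Function.ne_iff.mp Q.1.rep_nonzero
  have hj₀' : Q.1.rep j₀ ≠ 0 := hj₀
  set x : Fin (n + 1) → AlgebraicClosure k := (Q.1.rep j₀)⁻¹ • Q.1.rep with hxdef
  have hx : x ≠ 0 := smul_ne_zero (inv_ne_zero hj₀') Q.1.rep_nonzero
  have hQx : Q.1 = Projectivization.mk (AlgebraicClosure k) x hx := by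
    conv_lhs => rw [← Q.1.mk_rep]
    rw [Projectivization.mk_eq_mk_iff']
    exact ⟨Q.1.rep j₀, by rw [hxdef, smul_inv_smul₀ hj₀']⟩
  have hxmem : ∀ i, x i ∈ fieldOfPoint Q.1 := fun i =>
    IntermediateField.subset_adjoin k _
      ⟨i, j₀, hj₀', by simp [hxdef, div_eq_inv_mul]⟩
  have hW : W.VanishesAt (algebraMap k (AlgebraicClosure k)) x :=
    (W.mk_mem_points _ x hx).mp (hQx ▸ Q.2)
  obtain ⟨F, hF, hne⟩ := π.exists_rep _ x hx hW
  rw [π.map_eq_mk _ Q x hx hQx F hF hne, fieldOfPoint_mk, IntermediateField.adjoin_le_iff]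
  have hmem : ∀ G : MvPolynomial (Fin (n + 1)) k,
      eval₂ (algebraMap k (AlgebraicClosure k)) x G ∈ fieldOfPoint Q.1 := by
    intro G
    rw [eval₂_eq]
    refine sum_mem fun d _ => mul_mem (IntermediateField.algebraMap_mem _ _) ?_
    exact prod_mem fun i _ => pow_mem (hxmem i) _
  rintro z ⟨i, j, _, rfl⟩
  exact div_mem (hmem _) (hmem _)

/-- The places of `ℚ`: `some p` is the `p`-adic place and `none` is the archimedean place. -/
abbrev RatPlace := Option Nat.Primes

/-- The extension `F / E` of algebraic fields is ramified at most above places of `E` lying above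
places in `S`: each prime of the ring of integers of `E` that divides a prime number `p` not in `S`
is unramified in `F`, and, if `S` does not contain the archimedean place, so is each archimedean
place of `E`. -/
def IsUnramifiedOutside (S : Set RatPlace) (E F : Type*) [Field E] [Field F] [Algebra E F] :
    Prop :=
  (∀ p : Nat.Primes, some p ∉ S → ∀ 𝔭 : Ideal (NumberField.RingOfIntegers E), 𝔭.IsPrime →
    ((p : ℕ) : NumberField.RingOfIntegers E) ∈ 𝔭 →
      Algebra.IsUnramifiedIn (NumberField.RingOfIntegers F) 𝔭) ∧
  (none ∉ S → ∀ v : NumberField.InfinitePlace E, v.IsUnramifiedIn F)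

/-! A covering map is locally injective, so near the diagonal the fibre product of `W` with itself
over `V` has no complex points off the diagonal. This topological fact is turned into algebra over
`k`: in each chart `x i = 1` there is a polynomial `f i` in two sets of variables that is `1` on the
diagonal and vanishes on the fibre product off the diagonal (`exists_separating_polynomial`).
Clearing denominators gives integral polynomials `N i * f i`, and `S` consists of the archimedean
place and the primes dividing some `N i`.

Let `p` be a prime outside `S`, `𝔔` a prime over `p` in the normal closure of `k(Q)/k(P)`, and `σ`
in its inertia group over `k(P)`. Scale `Q` to have `𝔔`-integral coordinates `z`, one of them `1`.
As `σ` fixes `k(P)`, the pair `(z, σ z)` lies on the fibre product, and it is congruent to `(z, z)`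
modulo `𝔔`. If `σ z ≠ z`, then `N i * f i` takes the values `0` and `N i` at these two pairs, so `𝔔`
contains `N i`, which is prime to `p`: a contradiction. Hence inertia fixes `k(Q)`, which is
unramifiedness.

The passage from topology to algebra rests on a density statement (`exists_ringHom_near_ne_zero`):
on an irreducible affine variety over `k`, the complement of a proper hypersurface section is dense
for the complex topology. It is proved by Noether normalisation and continuity of roots. -/

/-! ### Extension of homomorphisms, and roots of complex polynomials. -/

/-- A homomorphism to an algebraically closed field extends along an integral extension. -/
theorem RingHom.IsIntegral.exists_comp_eq {R A K : Type*} [CommRing R] [CommRing A] [Field K]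
    [IsAlgClosed K] {f : R →+* A} (hf : f.IsIntegral) (φ : R →+* K)
    (hker : RingHom.ker f ≤ RingHom.ker φ) : ∃ ψ : A →+* K, ψ.comp f = φ := by
  algebraize [f]
  have hint : Algebra.IsIntegral R A := ⟨hf⟩
  have := RingHom.ker_isPrime φ
  -- By lying over, `A ⧸ Q` is integral over `R ⧸ ker φ`, which embeds in `K`; algebraic closedness
  -- extends the embedding.
  obtain ⟨Q, -, hQ, hQP⟩ := Ideal.exists_ideal_over_prime_of_isIntegral
    (S := A) (RingHom.ker φ) ⊥ hker
  have : Q.LiesOver (RingHom.ker φ) := ⟨hQP.symm⟩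
  let _ : Algebra (R ⧸ RingHom.ker φ) K := (RingHom.kerLift φ).toAlgebra
  have : FaithfulSMul (R ⧸ RingHom.ker φ) K :=
    (faithfulSMul_iff_algebraMap_injective _ _).mpr (RingHom.kerLift_injective φ)
  have : Module.IsTorsionFree (R ⧸ RingHom.ker φ) (A ⧸ Q) := by
    have : FaithfulSMul (R ⧸ RingHom.ker φ) (A ⧸ Q) := inferInstance
    exact Module.isTorsionFree_iff_faithfulSMul.mpr this
  let ψ : A ⧸ Q →ₐ[R ⧸ RingHom.ker φ] K := IsAlgClosed.lift
  refine ⟨(ψ : A ⧸ Q →+* K).comp (Ideal.Quotient.mk Q), RingHom.ext fun r => ?_⟩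
  exact ψ.commutes (Ideal.Quotient.mk (RingHom.ker φ) r)

/-- A monic complex polynomial has a root whose distance to a given point is controlled by its
value there. -/
theorem Polynomial.Monic.exists_root_pow_norm_sub_le {P : Polynomial ℂ} (hP : P.Monic)
    (hd : P.natDegree ≠ 0) (z : ℂ) :
    ∃ τ, P.eval τ = 0 ∧ ‖z - τ‖ ^ P.natDegree ≤ ‖P.eval z‖ := by
  have hs := IsAlgClosed.splits P
  have h1 : P.eval z = (P.roots.map fun a => z - a).prod := by
    conv_lhs => rw [hs.eq_prod_roots_of_monic hP]
    simp [Polynomial.eval_multiset_prod]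
  have hcard : P.roots.card = P.natDegree := hs.natDegree_eq_card_roots.symm
  have hne : P.roots.toFinset.Nonempty := by
    rw [Multiset.toFinset_nonempty, ← Multiset.card_pos, hcard]
    exact Nat.pos_of_ne_zero hd
  -- For the root `τ` nearest to `z`, every factor of `∏ (z - a)` has norm at least `‖z - τ‖`.
  obtain ⟨τ, hτ, hmin⟩ := Finset.exists_min_image _ (fun a => ‖z - a‖) hne
  refine ⟨τ, (Polynomial.mem_roots'.mp (Multiset.mem_toFinset.mp hτ)).2, ?_⟩
  have key : ∀ s : Multiset ℂ, (∀ a ∈ s, ‖z - τ‖ ≤ ‖z - a‖) →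
      ‖z - τ‖ ^ s.card ≤ ‖(s.map fun a => z - a).prod‖ := by
    intro s
    induction s using Multiset.induction with
    | empty => simp
    | cons a s ih =>
      intro h
      rw [Multiset.card_cons, Multiset.map_cons, Multiset.prod_cons, norm_mul, pow_succ']
      exact mul_le_mul (h a (Multiset.mem_cons_self a s))
        (ih fun b hb => h b (Multiset.mem_cons_of_mem hb)) (by positivity) (by positivity)
  rw [h1, ← hcard]
  exact key _ fun a ha => hmin a (Multiset.mem_toFinset.mpr ha)

/-- The roots of a monic complex polynomial are bounded in terms of its coefficients. -/
theorem Polynomial.Monic.norm_root_le {P : Polynomial ℂ} (hP : P.Monic) {y : ℂ}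
    (hy : P.eval y = 0) : ‖y‖ ≤ ∑ j ∈ Finset.range P.natDegree, ‖P.coeff j‖ + 1 := by
  have h := Polynomial.IsRoot.norm_lt_cauchyBound hP.ne_zero (show P.IsRoot y from hy)
  rw [Polynomial.cauchyBound, hP.leadingCoeff, nnnorm_one, div_one] at h
  have h2 : (Finset.range P.natDegree).sup (fun j => ‖P.coeff j‖₊) ≤
      ∑ j ∈ Finset.range P.natDegree, ‖P.coeff j‖₊ :=
    Finset.sup_le fun j hj => Finset.single_le_sum (f := fun j => ‖P.coeff j‖₊) (fun _ _ => zero_le) hj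
  have h3 : ‖y‖₊ ≤ ∑ j ∈ Finset.range P.natDegree, ‖P.coeff j‖₊ + 1 := h.le.trans (by gcongr)
  simpa using NNReal.coe_le_coe.mpr h3

/-- A linear form with coefficients in an infinite subfield that separates finitely many points
from zero. -/
theorem exists_linear_form_ne_zero {k K ι : Type*} [Field k] [Infinite k] [Field K] [Fintype ι]
    (φ : k →+* K) (R : Finset (ι → K)) (hR : ∀ r ∈ R, r ≠ 0) :
    ∃ c : ι → k, ∀ r ∈ R, ∑ i, φ (c i) * r i ≠ 0 := by
  classical
  by_contra! hcon
  -- If every `c` failed, this product of non-zero linear forms would vanish on all tuples from the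
  -- infinite set `φ(k)`, hence be zero.
  set p : MvPolynomial ι K := ∏ r ∈ R, ∑ i, C (r i) * X i with hp
  have hp0 : p = 0 := by
    apply MvPolynomial.funext_set (fun _ => Set.range φ)
      (fun _ => Set.infinite_range_of_injective φ.injective)
    intro x hx
    choose c hc using fun i => hx i (Set.mem_univ i)
    obtain ⟨r, hr, h0⟩ := hcon c
    rw [hp, map_prod, map_zero]
    refine Finset.prod_eq_zero hr ?_
    rw [← h0]
    simp [hc, mul_comm]
  rw [hp, Finset.prod_eq_zero_iff] at hp0
  obtain ⟨r, hr, h0⟩ := hp0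
  refine hR r hr (funext fun i => ?_)
  have := congrArg (eval (Pi.single i (1 : K))) h0
  simpa [Pi.single_apply] using this

/-- Over a polynomial ring, roots of the specialised minimal polynomial of an integral element
lift to homomorphisms. -/
theorem exists_ringHom_of_minpoly_root {B A K : Type*} [CommRing B] [IsDomain B]
    [IsIntegrallyClosed B] [CommRing A] [IsDomain A] [Algebra B A] [FaithfulSMul B A]
    [Algebra.IsIntegral B A] [Field K] [IsAlgClosed K] (t : B →+* K) (u : A) (τ : K)
    (hτ : (minpoly B u).eval₂ t τ = 0) :
    ∃ ψ : A →+* K, ψ.comp (algebraMap B A) = t ∧ ψ u = τ := by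
  have hu : IsIntegral B u := Algebra.IsIntegral.isIntegral u
  -- Since `B` is integrally closed, `B[u]` is `B[T]` modulo the minimal polynomial. So `τ` defines
  -- a homomorphism on `B[u]`, and it extends to `A`, which is integral over `B[u]`.
  let f : AdjoinRoot (minpoly B u) →ₐ[B] A :=
    (Algebra.adjoin B {u}).val.comp (AdjoinRoot.Minpoly.toAdjoin B u)
  have hfinj : Function.Injective f :=
    Subtype.val_injective.comp (minpoly.ToAdjoin.injective hu)
  have hfu : f (AdjoinRoot.root _) = u := by simp [f]
  have hfint : (f : AdjoinRoot (minpoly B u) →+* A).IsIntegral := by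
    refine RingHom.IsIntegral.tower_top (algebraMap B _) _ ?_
    have : (f : AdjoinRoot (minpoly B u) →+* A).comp (algebraMap B _) = algebraMap B A :=
      f.comp_algebraMap
    rw [this]
    exact Algebra.IsIntegral.isIntegral
  obtain ⟨ψ, hψ⟩ := hfint.exists_comp_eq (AdjoinRoot.lift t τ hτ) (by
    rw [(RingHom.injective_iff_ker_eq_bot (f : AdjoinRoot (minpoly B u) →+* A)).mp hfinj]
    exact bot_le)
  refine ⟨ψ, ?_, ?_⟩
  · ext b
    have := congrArg (fun g => g (algebraMap B _ b)) hψ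
    simp only [RingHom.comp_apply, RingHom.coe_coe, f.commutes] at this
    rw [RingHom.comp_apply, this, AdjoinRoot.algebraMap_eq, AdjoinRoot.lift_of]
  · have := congrArg (fun g => g (AdjoinRoot.root _)) hψ
    simpa [hfu] using this

/-! ### Density of non-vanishing loci in the complex topology. -/

/-- A non-zero polynomial is non-zero at points arbitrarily close to any given point. -/
theorem MvPolynomial.exists_seq_tendsto_eval₂_ne_zero {k : Type*} [Field k] {s : ℕ} (φ : k →+* ℂ)
    {h : MvPolynomial (Fin s) k} (hh : h ≠ 0) (t₀ : Fin s → ℂ) :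
    ∃ t : ℕ → Fin s → ℂ, Filter.Tendsto t Filter.atTop (nhds t₀) ∧
      ∀ n, eval₂ φ (t n) h ≠ 0 := by
  obtain ⟨c, hc⟩ : ∃ c : Fin s → ℂ, eval₂ φ c h ≠ 0 := by
    by_contra! hcon
    apply hh
    apply MvPolynomial.map_injective φ φ.injective
    apply MvPolynomial.funext
    intro x
    simpa [eval_map] using hcon x
  -- The restriction of `h` to the line through `t₀` and `c` is non-zero at parameter `1`, so it has
  -- finitely many roots.
  set p : Polynomial ℂ := eval₂ (Polynomial.C.comp φ)
    (fun i => Polynomial.C (t₀ i) + Polynomial.X * Polynomial.C (c i - t₀ i)) h with hp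
  have hpe : ∀ l : ℂ, p.eval l = eval₂ φ (t₀ + l • (c - t₀)) h := by
    intro l
    rw [hp, ← Polynomial.coe_evalRingHom, hom_eval₂]
    congr 1
    · ext; simp
    · ext i; simp
  have hp0 : p ≠ 0 := by
    intro h0
    apply hc
    have := hpe 1
    rw [h0] at this
    simpa using this.symm
  have hev : ∀ᶠ l in nhdsWithin (0 : ℂ) {0}ᶜ, p.eval l ≠ 0 := by
    have hfin : {l | p.eval l = 0}.Finite := by
      simpa [Polynomial.IsRoot] using Polynomial.finite_setOfPred_isRoot hp0
    have : ({l | p.eval l = 0} \ {0})ᶜ ∈ nhds (0 : ℂ) :=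
      (hfin.subset Set.sdiff_subset).isClosed.isOpen_compl.mem_nhds (by simp)
    filter_upwards [nhdsWithin_le_nhds this, self_mem_nhdsWithin] with l h1 h2 h3
    exact h1 ⟨h3, h2⟩
  obtain ⟨l, hl, hln⟩ := Filter.exists_seq_forall_of_frequently hev.frequently
  refine ⟨fun n => t₀ + l n • (c - t₀), ?_, fun n => ?_⟩
  · have h1 : Filter.Tendsto l Filter.atTop (nhds 0) := hl.mono_right nhdsWithin_le_nhds
    have := (tendsto_const_nhds (x := t₀)).add (h1.smul_const (c - t₀))
    simpa using this
  · rw [← hpe]; exact hln n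

/-- Complex points of a finitely generated domain at which a given non-zero element does not vanish
are dense, in the complex topology, in the set of all complex points. -/
theorem exists_ringHom_near_ne_zero {k A ι : Type*} [Field k] [Infinite k] [Fintype ι] [CommRing A]
    [IsDomain A] [Algebra k A] [Algebra.FiniteType k A] (φ : k →+* ℂ) (ψ₀ : A →+* ℂ)
    (hψ₀ : ψ₀.comp (algebraMap k A) = φ) (x : ι → A) {g : A} (hg : g ≠ 0) {ε : ℝ} (hε : 0 < ε) :
    ∃ ψ : A →+* ℂ, ψ.comp (algebraMap k A) = φ ∧ ψ g ≠ 0 ∧ ∀ i, ‖ψ (x i) - ψ₀ (x i)‖ < ε := by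
  classical
  -- Noether normalisation: points of `A` lie finitely over affine space. The plan is to move the
  -- base point and to lift the motion to a point that stays close to `ψ₀`.
  obtain ⟨s, e, hinj, hint⟩ := exists_integral_inj_algHom_of_fg k A
  set B := MvPolynomial (Fin s) k with hB
  let _ : Algebra B A := e.toRingHom.toAlgebra
  have : Algebra.IsIntegral B A := ⟨hint⟩
  have : FaithfulSMul B A := (faithfulSMul_iff_algebraMap_injective _ _).mpr hinj
  have hek : (algebraMap B A).comp C = algebraMap k A := e.comp_algebraMap
  -- As `g` divides `h`, it suffices to avoid the zeros of `h` on the base.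
  obtain ⟨h, hh, hgh⟩ := (Algebra.IsAlgebraic.isAlgebraic (R := B) g).exists_nonzero_dvd
    (mem_nonZeroDivisors_of_ne_zero hg)
  set t₀ : Fin s → ℂ := fun i => ψ₀ (algebraMap B A (X i)) with ht₀
  obtain ⟨t, ht, hth⟩ := MvPolynomial.exists_seq_tendsto_eval₂_ne_zero φ hh t₀
  have hψB : ψ₀.comp (algebraMap B A) = eval₂Hom φ t₀ := by
    ext i
    · rw [RingHom.comp_assoc, hek, hψ₀]; simp
    · simp [ht₀]
  have hcont : ∀ b : B, Filter.Tendsto (fun n => eval₂ φ (t n) b) Filter.atTop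
      (nhds (ψ₀ (algebraMap B A b))) := by
    intro b
    have h1 : ψ₀ (algebraMap B A b) = eval₂ φ t₀ b := congrArg (fun f => f b) hψB
    rw [h1]
    have hc : Continuous fun y : Fin s → ℂ => eval₂ φ y b := by
      simp only [eval₂_eq]
      fun_prop
    exact (hc.tendsto t₀).comp ht
  let q : ι → Polynomial B := fun i => minpoly B (x i)
  have hq : ∀ i, (q i).Monic := fun i => minpoly.monic (Algebra.IsIntegral.isIntegral _)
  have hqroot : ∀ (i) (ψ : A →+* ℂ),
      ((q i).map (ψ.comp (algebraMap B A))).eval (ψ (x i)) = 0 := by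
    intro i ψ
    rw [Polynomial.eval_map, ← Polynomial.hom_eval₂]
    have : (q i).eval₂ (algebraMap B A) (x i) = 0 := minpoly.aeval B (x i)
    rw [this, map_zero]
  let z : ι → ℂ := fun i => ψ₀ (x i)
  -- Limits of lifted points have as coordinates roots of the minimal polynomials specialised at
  -- `t₀`. These are finitely many candidates, and the form `c` tells each of them apart from `z`.
  -- Its coefficients lie in `k` so that `u` is an element of `A`.
  let R : Finset (ι → ℂ) := ((Fintype.piFinset fun i =>
    ((q i).map (ψ₀.comp (algebraMap B A))).roots.toFinset).image fun r => r - z).erase 0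
  obtain ⟨c, hc⟩ := exists_linear_form_ne_zero φ R fun r hr => Finset.ne_of_mem_erase hr
  let u : A := ∑ i, algebraMap k A (c i) * x i
  have hu : ∀ ψ : A →+* ℂ, ψ.comp (algebraMap k A) = φ → ψ u = ∑ i, φ (c i) * ψ (x i) := by
    intro ψ hψ
    simp only [u, map_sum, map_mul, ← hψ, RingHom.comp_apply]
  have hmon : (minpoly B u).Monic := minpoly.monic (Algebra.IsIntegral.isIntegral _)
  have hdeg : (minpoly B u).natDegree ≠ 0 :=
    (minpoly.natDegree_pos (Algebra.IsIntegral.isIntegral (R := B) u)).ne'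
  have hτ : ∀ n, ∃ τ : ℂ, ((minpoly B u).map (eval₂Hom φ (t n))).eval τ = 0 ∧
      ‖ψ₀ u - τ‖ ^ (minpoly B u).natDegree ≤
        ‖((minpoly B u).map (eval₂Hom φ (t n))).eval (ψ₀ u)‖ := by
    intro n
    have := (hmon.map (eval₂Hom φ (t n))).exists_root_pow_norm_sub_le
      (by rwa [hmon.natDegree_map]) (ψ₀ u)
    rwa [hmon.natDegree_map] at this
  choose τ hτ0 hτ using hτ
  have hlift : ∀ n, ∃ ψ : A →+* ℂ, ψ.comp (algebraMap B A) = eval₂Hom φ (t n) ∧ ψ u = τ n :=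
    fun n => exists_ringHom_of_minpoly_root _ u _ (by rw [← Polynomial.eval_map]; exact hτ0 n)
  choose ψ hψB' hψu using hlift
  have hψk : ∀ n, (ψ n).comp (algebraMap k A) = φ := by
    intro n
    rw [← hek, ← RingHom.comp_assoc, hψB']
    exact RingHom.ext fun _ => eval₂_C _ _ _
  have hψg : ∀ n, ψ n g ≠ 0 := by
    intro n h0
    obtain ⟨a, ha⟩ := hgh
    apply hth n
    have : ψ n (algebraMap B A h) = eval₂ φ (t n) h := congrArg (fun f => f h) (hψB' n)
    rw [← this, ha, map_mul, h0, zero_mul]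
  have hevalt : ∀ (p : Polynomial B) (y : ℕ → ℂ) (y₀ : ℂ),
      Filter.Tendsto y Filter.atTop (nhds y₀) → ∀ σ : ℕ → ℕ, StrictMono σ →
      Filter.Tendsto (fun n => (p.map (eval₂Hom φ (t (σ n)))).eval (y n)) Filter.atTop
        (nhds ((p.map (ψ₀.comp (algebraMap B A))).eval y₀)) := by
    intro p y y₀ hy σ hσ
    simp only [Polynomial.eval_map, Polynomial.eval₂_eq_sum_range]
    refine tendsto_finsetSum _ fun j _ => ((hcont _).comp hσ.tendsto_atTop).mul (hy.pow j)
  -- The specialised polynomials at `ψ₀ u` tend to `0`, which forces their nearest roots to tend to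
  -- `ψ₀ u`.
  have hτlim : Filter.Tendsto τ Filter.atTop (nhds (ψ₀ u)) := by
    have h1 := hevalt (minpoly B u) (fun _ => ψ₀ u) (ψ₀ u) tendsto_const_nhds id strictMono_id
    have h2 : ((minpoly B u).map (ψ₀.comp (algebraMap B A))).eval (ψ₀ u) = 0 := by
      rw [Polynomial.eval_map, ← Polynomial.hom_eval₂]
      have : (minpoly B u).eval₂ (algebraMap B A) u = 0 := minpoly.aeval B u
      rw [this, map_zero]
    rw [h2] at h1
    have h3 : Filter.Tendsto (fun n => ‖ψ₀ u - τ n‖ ^ (minpoly B u).natDegree) Filter.atTop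
        (nhds 0) :=
      squeeze_zero (fun n => by positivity) hτ (by simpa using h1.norm)
    rw [tendsto_iff_norm_sub_tendsto_zero]
    rw [Metric.tendsto_atTop] at h3 ⊢
    intro δ hδ
    obtain ⟨N, hN⟩ := h3 (δ ^ (minpoly B u).natDegree) (by positivity)
    refine ⟨N, fun n hn => ?_⟩
    have := hN n hn
    rw [dist_zero_right, Real.norm_of_nonneg (by positivity)] at this ⊢
    rw [norm_sub_rev]
    exact lt_of_pow_lt_pow_left₀ _ hδ.le this
  -- The coordinates are roots of monic polynomials whose coefficients converge; a convergent
  -- subsequence can then be extracted.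
  have hbdd : ∃ M, ∀ n i, ‖ψ n (x i)‖ ≤ M := by
    have h1 : ∀ i, ∃ M, ∀ n, ‖ψ n (x i)‖ ≤ M := by
      intro i
      have h2 : ∀ j, ∃ M, ∀ n, ‖eval₂ φ (t n) ((q i).coeff j)‖ ≤ M := by
        intro j
        obtain ⟨M, hM⟩ := ((hcont ((q i).coeff j)).norm).bddAbove_range
        exact ⟨M, fun n => hM ⟨n, rfl⟩⟩
      choose M hM using h2
      refine ⟨∑ j ∈ Finset.range (q i).natDegree, M j + 1, fun n => ?_⟩
      have h3 := ((hq i).map (eval₂Hom φ (t n))).norm_root_le (y := ψ n (x i))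
        (by rw [← hψB']; exact hqroot i (ψ n))
      rw [(hq i).natDegree_map] at h3
      refine h3.trans ?_
      gcongr with j hj
      rw [Polynomial.coeff_map]
      exact hM j n
    choose M hM using h1
    exact ⟨∑ i, |M i|, fun n i => (hM i n).trans ((le_abs_self _).trans
      (Finset.single_le_sum (f := fun i => |M i|) (fun _ _ => abs_nonneg _) (Finset.mem_univ i)))⟩
  obtain ⟨M, hM⟩ := hbdd
  obtain ⟨a, -, σ, hσ, ha⟩ := tendsto_subseq_of_bounded
    (Metric.isBounded_closedBall (x := (0 : ι → ℂ)) (r := max M 0))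
    (x := fun n i => ψ n (x i)) (fun n => by
      rw [mem_closedBall_zero_iff, pi_norm_le_iff_of_nonneg (le_max_right _ _)]
      exact fun i => (hM n i).trans (le_max_left _ _))
  have hai : ∀ i, Filter.Tendsto (fun n => ψ (σ n) (x i)) Filter.atTop (nhds (a i)) :=
    fun i => tendsto_pi_nhds.mp ha i
  have haroot : ∀ i, ((q i).map (ψ₀.comp (algebraMap B A))).eval (a i) = 0 := by
    intro i
    refine tendsto_nhds_unique (hevalt (q i) _ _ (hai i) σ hσ) ?_
    refine tendsto_const_nhds.congr fun n => ?_
    rw [← hψB']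
    exact (hqroot i (ψ (σ n))).symm
  -- The limit `a` is one of the candidates, and `u` takes the same value there as at `z`.
  have haz : a = z := by
    by_contra hne
    have hmem : a - z ∈ R := by
      refine Finset.mem_erase.mpr ⟨sub_ne_zero.mpr hne, Finset.mem_image.mpr ⟨a, ?_, rfl⟩⟩
      rw [Fintype.mem_piFinset]
      intro i
      rw [Multiset.mem_toFinset, Polynomial.mem_roots']
      exact ⟨((hq i).map _).ne_zero, haroot i⟩
    apply hc _ hmem
    have h1 : Filter.Tendsto (fun n => ψ (σ n) u) Filter.atTop
        (nhds (∑ i, φ (c i) * a i)) := by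
      simp only [hu _ (hψk _)]
      exact tendsto_finsetSum _ fun i _ => (hai i).const_mul _
    have h2 : Filter.Tendsto (fun n => ψ (σ n) u) Filter.atTop (nhds (ψ₀ u)) := by
      simp only [hψu]
      exact hτlim.comp hσ.tendsto_atTop
    have h3 := tendsto_nhds_unique h1 h2
    rw [hu _ hψ₀] at h3
    simp only [Pi.sub_apply, mul_sub, Finset.sum_sub_distrib, h3, z, sub_self]
  have hfin : ∀ᶠ n in Filter.atTop, ∀ i, ‖ψ (σ n) (x i) - ψ₀ (x i)‖ < ε := by
    rw [Filter.eventually_all]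
    intro i
    have h1 := hai i
    rw [haz] at h1
    have := (Metric.tendsto_nhds.mp h1) ε hε
    simpa [dist_eq_norm, z] using this
  obtain ⟨n, hn⟩ := hfin.exists
  exact ⟨ψ (σ n), hψk _, hψg _, hn⟩

/-- Over a prime ideal `𝔭` contained in the ideal of a complex point `z`, there are zeros of `𝔭`
arbitrarily close to `z` outside a given hypersurface not containing the zero locus of `𝔭`. -/
theorem MvPolynomial.exists_zero_near_eval₂_ne_zero {k ι : Type*} [Field k] [Infinite k] [Fintype ι]
    (φ : k →+* ℂ) (𝔭 : Ideal (MvPolynomial ι k)) [𝔭.IsPrime] (z : ι → ℂ)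
    (hz : ∀ f ∈ 𝔭, eval₂ φ z f = 0) {g : MvPolynomial ι k} (hg : g ∉ 𝔭) {ε : ℝ} (hε : 0 < ε) :
    ∃ v : ι → ℂ, (∀ i, ‖v i - z i‖ < ε) ∧ (∀ f ∈ 𝔭, eval₂ φ v f = 0) ∧ eval₂ φ v g ≠ 0 := by
  let ψ₀ : MvPolynomial ι k ⧸ 𝔭 →+* ℂ := Ideal.Quotient.lift 𝔭 (eval₂Hom φ z) hz
  have hψ₀ : ∀ f, ψ₀ (Ideal.Quotient.mk 𝔭 f) = eval₂ φ z f := fun f => rfl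
  obtain ⟨ψ, hψ, hψg, hψx⟩ := exists_ringHom_near_ne_zero φ ψ₀
    (RingHom.ext fun a => by
      change eval₂ φ z (C a) = φ a
      simp)
    (fun i => Ideal.Quotient.mk 𝔭 (X i)) (g := Ideal.Quotient.mk 𝔭 g)
    (by rwa [Ne, Ideal.Quotient.eq_zero_iff_mem]) hε
  have key : ∀ f, ψ (Ideal.Quotient.mk 𝔭 f) =
      eval₂ φ (fun i => ψ (Ideal.Quotient.mk 𝔭 (X i))) f := by
    intro f
    have : ψ.comp (Ideal.Quotient.mk 𝔭) =
        eval₂Hom φ (fun i => ψ (Ideal.Quotient.mk 𝔭 (X i))) := by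
      ext i
      · rw [← hψ]; simp; rfl
      · simp
    exact congrArg (fun h => h f) this
  refine ⟨fun i => ψ (Ideal.Quotient.mk 𝔭 (X i)), fun i => ?_, fun f hf => ?_, ?_⟩
  · have := hψx i
    rwa [hψ₀, eval₂_X] at this
  · rw [← key, Ideal.Quotient.eq_zero_iff_mem.mpr hf, map_zero]
  · rw [← key]; exact hψg

/-- If, near a complex zero `z` of the ideal `I`, all zeros of `I` are zeros of each `g j`, then
some polynomial that does not vanish at `z` multiplies a power of each `g j` into `I`. -/
theorem MvPolynomial.exists_pow_mul_mem_of_eventually {k ι J : Type*} [Field k] [Infinite k]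
    [Fintype ι] [Finite J] (φ : k →+* ℂ) (I : Ideal (MvPolynomial ι k)) (g : J → MvPolynomial ι k)
    (z : ι → ℂ) {ε : ℝ} (hε : 0 < ε)
    (hloc : ∀ v : ι → ℂ, (∀ i, ‖v i - z i‖ < ε) → (∀ f ∈ I, eval₂ φ v f = 0) →
      ∀ j, eval₂ φ v (g j) = 0) :
    ∃ f, eval₂ φ z f ≠ 0 ∧ ∀ j, ∃ N : ℕ, g j ^ N * f ∈ I := by
  have key : ∀ j, ∃ f, eval₂ φ z f ≠ 0 ∧ ∃ N : ℕ, g j ^ N * f ∈ I := by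
    intro j
    by_contra! hcon
    have := RingHom.ker_isPrime (eval₂Hom φ z)
    -- A prime containing `I` and disjoint from `S` has `z` as a zero and does not contain `g j`;
    -- density then yields a zero of `I` near `z` with `g j ≠ 0`.
    let S : Submonoid (MvPolynomial ι k) :=
      (RingHom.ker (eval₂Hom φ z)).primeCompl ⊔ Submonoid.powers (g j)
    have hdisj : Disjoint (I : Set (MvPolynomial ι k)) S := by
      rw [Set.disjoint_left]
      intro f hf hfS
      obtain ⟨a, ha, b, ⟨N, rfl⟩, rfl⟩ := Submonoid.mem_sup.mp hfS
      exact hcon a ha N (by rw [mul_comm]; exact hf)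
    obtain ⟨𝔭, h𝔭, hI𝔭, h𝔭S⟩ := Ideal.exists_le_prime_disjoint I S hdisj
    rw [Set.disjoint_left] at h𝔭S
    obtain ⟨v, hv, hv𝔭, hvg⟩ := exists_zero_near_eval₂_ne_zero φ 𝔭 z
      (fun f hf => by
        by_contra h0
        exact h𝔭S hf (Submonoid.mem_sup_left h0))
      (g := g j) (fun hg => h𝔭S hg (Submonoid.mem_sup_right (Submonoid.mem_powers _))) hε
    exact hvg (hloc v hv (fun f hf => hv𝔭 f (hI𝔭 hf)) j)
  choose f hf N hN using key
  have := Fintype.ofFinite J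
  refine ⟨∏ j, f j, ?_, fun j => ⟨N j, ?_⟩⟩
  · rw [← coe_eval₂Hom, map_prod]
    exact Finset.prod_ne_zero_iff.mpr fun j _ => hf j
  · classical
    rw [← Finset.mul_prod_erase _ _ (Finset.mem_univ j), ← mul_assoc]
    exact I.mul_mem_right _ (hN j)

/-! ### Inertia groups, valuations and denominators. -/

open NumberField in
/-- If the inertia groups at the primes over `𝔭` in a Galois extension `L / E` fix the intermediate
field `F`, then `𝔭` is unramified in `F`. -/
theorem NumberField.isUnramifiedIn_of_inertia_fixes {E F L : Type*} [Field E] [Field F] [Field L]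
    [NumberField E] [NumberField F] [NumberField L] [Algebra E F] [Algebra F L] [Algebra E L]
    [IsScalarTower E F L] [IsGalois E L] (𝔭 : Ideal (𝓞 E)) [𝔭.IsPrime]
    (h : ∀ 𝔔 : Ideal (𝓞 L), 𝔔.IsPrime → 𝔔.LiesOver 𝔭 → ∀ σ : Gal(L/E),
      (∀ a : 𝓞 L, σ • a - a ∈ 𝔔) → ∀ x : F, σ (algebraMap F L x) = algebraMap F L x) :
    Algebra.IsUnramifiedIn (𝓞 F) 𝔭 := by
  intro 𝔓 h𝔓 h𝔓𝔭
  obtain ⟨⟨𝔔, h𝔔, h𝔔𝔓⟩⟩ := Ideal.nonempty_primesOver (S := 𝓞 L) 𝔓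
  have : IsGalois F L := IsGalois.tower_top_of_isGalois E F L
  have : IsGaloisGroup Gal(L/E) (𝓞 E) (𝓞 L) := .of_isFractionRing _ _ _ E L
  have : IsGaloisGroup Gal(L/F) (𝓞 F) (𝓞 L) := .of_isFractionRing _ _ _ F L
  have h𝔔𝔭 : 𝔔.LiesOver 𝔭 := Ideal.LiesOver.trans 𝔔 𝔓 𝔭
  rw [← Ideal.ramificationIdx_eq_one_iff]
  have h1 := Ideal.card_inertia_eq_ramificationIdxIn (G := Gal(L/E)) 𝔭 𝔔
  have h2 := Ideal.card_inertia_eq_ramificationIdxIn (G := Gal(L/F)) 𝔓 𝔔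
  rw [Ideal.ramificationIdxIn_eq_ramificationIdx 𝔭 𝔔 Gal(L/E)] at h1
  rw [Ideal.ramificationIdxIn_eq_ramificationIdx 𝔓 𝔔 Gal(L/F)] at h2
  have h3 := Ideal.ramificationIdx_tower (R := 𝓞 E) 𝔓 𝔔
  -- Inertia elements fix `F`, so they lie in `Gal(L/F)`. The inertia orders are ramification
  -- indices, and multiplicativity in the tower leaves index at most `1` for `𝔓` over `𝔭`.
  have hle : Nat.card (𝔔.inertia Gal(L/E)) ≤ Nat.card (𝔔.inertia Gal(L/F)) := by
    refine Nat.card_le_card_of_injective (fun σ => ⟨AlgEquiv.ofRingEquiv (f := (σ.1 : L ≃+* L))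
      (fun x => h 𝔔 h𝔔 h𝔔𝔭 σ.1 σ.2 x), fun a => σ.2 a⟩) ?_
    intro σ τ hστ
    ext x
    exact congrArg (fun s => s.1 x) hστ
  rw [h1, h2] at hle
  have hpos : 0 < 𝔔.ramificationIdx (𝓞 F) := Ideal.ramificationIdx_pos 𝔔 (𝓞 F)
  have hpos' : 0 < 𝔓.ramificationIdx (𝓞 E) := Ideal.ramificationIdx_pos 𝔓 (𝓞 E)
  rw [h3] at hle
  nlinarith

/-- Values of an integral polynomial at integral points that are congruent modulo the maximal ideal
of a valuation are congruent. -/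
theorem MvPolynomial.valuation_eval₂_sub_lt_one {R L Γ ι : Type*} [CommRing R] [Field L]
    [LinearOrderedCommGroupWithZero Γ] (v : Valuation L Γ) (σ : R →+* L) (hσ : ∀ r, v (σ r) ≤ 1)
    {a b : ι → L} (ha : ∀ i, v (a i) ≤ 1) (hb : ∀ i, v (b i) ≤ 1) (hab : ∀ i, v (a i - b i) < 1)
    (f : MvPolynomial ι R) : v (eval₂ σ a f - eval₂ σ b f) < 1 := by
  -- Integrality of the value at `b` is carried along because the product step needs it.
  suffices h : v (eval₂ σ b f) ≤ 1 ∧ v (eval₂ σ a f - eval₂ σ b f) < 1 from h.2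
  induction f using MvPolynomial.induction_on with
  | C r => simpa using hσ r
  | add p q hp hq =>
    simp only [eval₂_add]
    refine ⟨(v.map_add _ _).trans (max_le hp.1 hq.1), ?_⟩
    rw [add_sub_add_comm]
    exact v.map_add_lt hp.2 hq.2
  | mul_X p i hp =>
    simp only [eval₂_mul, eval₂_X]
    refine ⟨by rw [map_mul]; exact mul_le_one' hp.1 (hb i), ?_⟩
    have : eval₂ σ a p * a i - eval₂ σ b p * b i =
        (eval₂ σ a p - eval₂ σ b p) * a i + eval₂ σ b p * (a i - b i) := by ring
    rw [this]
    refine v.map_add_lt ?_ ?_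
    · rw [map_mul]; exact mul_lt_one_of_nonneg_of_lt_one_left zero_le hp.2 (ha i)
    · rw [map_mul]; exact mul_lt_one_of_nonneg_of_lt_one_right hp.1 zero_le (hab i)

open NumberField IsDedekindDomain in
/-- An element of the inertia group acts trivially on the residues of integral elements. -/
theorem NumberField.valuation_inertia {E L : Type*} [Field E] [Field L] [NumberField L]
    [Algebra E L] (v : HeightOneSpectrum (𝓞 L)) (σ : Gal(L/E))
    (hσ : ∀ a : 𝓞 L, σ • a - a ∈ v.asIdeal) {x : L} (hx : v.valuation L x ≤ 1) :
    v.valuation L (σ x) ≤ 1 ∧ v.valuation L (x - σ x) < 1 := by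
  -- An element integral at `v` is a fraction with denominator prime to `v`, which reduces the claim
  -- to the action on `𝓞 L`.
  obtain ⟨a, d, hd, h⟩ : ∃ a d : 𝓞 L, d ∉ v.asIdeal ∧ x * (d : L) = a := by
    obtain ⟨a, d, h | h⟩ := v.exists_primeCompl_mul_eq_or_mul_eq (K := L) x
    · exact ⟨a, d, d.2, h⟩
    · refine ⟨d, a, fun ha => ?_, h⟩
      have h1 : v.valuation L (algebraMap (𝓞 L) L d) = 1 := v.valuation_eq_one_iff_notMem.mpr d.2
      have h2 : v.valuation L (algebraMap (𝓞 L) L a) < 1 := (v.valuation_lt_one_iff_mem _).mpr ha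
      rw [← h, map_mul] at h1
      exact (mul_lt_one_of_nonneg_of_lt_one_right hx zero_le h2).ne h1
  have hσd : σ • d ∉ v.asIdeal := fun h1 => hd (by
    have := sub_mem h1 (hσ d)
    rwa [sub_sub_cancel] at this)
  have hco : ∀ b : 𝓞 L, ((σ • b : 𝓞 L) : L) = σ b := fun b => rfl
  have hd1 : v.valuation L (d : L) = 1 := v.valuation_eq_one_iff_notMem.mpr hd
  have hσd1 : v.valuation L (σ d : L) = 1 := by
    rw [← hco]; exact v.valuation_eq_one_iff_notMem.mpr hσd
  have hσh : σ x * σ (d : L) = σ (a : L) := by rw [← map_mul, h]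
  have hσx : v.valuation L (σ x) ≤ 1 := by
    have h1 : v.valuation L (σ x * σ (d : L)) ≤ 1 := by
      rw [hσh, ← hco]
      exact v.valuation_le_one _
    rwa [map_mul, hσd1, mul_one] at h1
  have hlt : ∀ b : 𝓞 L, v.valuation L (σ b - b) < 1 := fun b => by
    rw [← hco, ← map_sub]
    exact (v.valuation_lt_one_iff_mem _).mpr (hσ b)
  refine ⟨hσx, ?_⟩
  have key : (x - σ x) * (d : L) = σ x * (σ d - d) - (σ a - a) := by
    rw [mul_sub, hσh, sub_mul, h]; ring
  have h1 : v.valuation L ((x - σ x) * (d : L)) < 1 := by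
    rw [key]
    refine (v.valuation L).map_sub_lt ?_ (hlt a)
    rw [map_mul]
    exact mul_lt_one_of_nonneg_of_lt_one_right hσx zero_le (hlt d)
  rwa [map_mul, hd1, mul_one] at h1

open NumberField in
/-- A polynomial over a number field becomes integral after multiplication by a non-zero integer. -/
theorem NumberField.exists_map_eq_intCast_mul {k ι : Type*} [Field k] [NumberField k]
    (f : MvPolynomial ι k) : ∃ (N : ℤ) (g : MvPolynomial ι (𝓞 k)), N ≠ 0 ∧
      map (algebraMap (𝓞 k) k) g = C (N : k) * f := by
  classical
  obtain ⟨N, hN, h⟩ := exists_integral_multiples ℤ ℚ (f.support.image f.coeff)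
  have h2 : C (N : k) * f ∈ Set.range (map (σ := ι) (algebraMap (𝓞 k) k)) := by
    rw [mem_range_map_iff_coeffs_subset]
    intro c hc
    obtain ⟨m, hm, rfl⟩ := mem_coeffs_iff.mp hc
    have hm' : m ∈ f.support := by
      rw [mem_support_iff] at hm ⊢
      rw [coeff_C_mul] at hm
      exact right_ne_zero_of_mul hm
    have := h _ (Finset.mem_image_of_mem f.coeff hm')
    rw [coeff_C_mul]
    rw [zsmul_eq_mul] at this
    exact ⟨⟨_, this⟩, rfl⟩
  obtain ⟨g, hg⟩ := h2
  exact ⟨N, g, hN, hg⟩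

/-! ### The fibre product and its separating polynomials. -/

/-- **Nullstellensatz**: a proper ideal has a zero in every algebraically closed extension. -/
theorem MvPolynomial.exists_zero_of_ne_top {k K ι : Type*} [Field k] [Field K] [IsAlgClosed K]
    [Finite ι] (φ : k →+* K) {I : Ideal (MvPolynomial ι k)} (hI : I ≠ ⊤) :
    ∃ w : ι → K, ∀ f ∈ I, eval₂ φ w f = 0 := by
  obtain ⟨M, hM, hIM⟩ := Ideal.exists_le_maximal I hI
  let _ := Ideal.Quotient.field M
  have hfin : Module.Finite k (MvPolynomial ι k ⧸ M) := finite_of_finite_type_of_isJacobsonRing k _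
  obtain ⟨ψ, hψ⟩ := RingHom.IsIntegral.exists_comp_eq (f := algebraMap k (MvPolynomial ι k ⧸ M))
    (fun x => Algebra.IsIntegral.isIntegral x) φ
    (by rw [(RingHom.injective_iff_ker_eq_bot _).mp (algebraMap k _).injective]; exact bot_le)
  refine ⟨fun i => ψ (Ideal.Quotient.mk M (X i)), fun f hf => ?_⟩
  have h1 : eval₂Hom φ (fun i => ψ (Ideal.Quotient.mk M (X i))) =
      ψ.comp (Ideal.Quotient.mk M) := by
    ext i
    · rw [← hψ]; simp; rfl
    · simp
  have h2 := congrArg (fun h => h f) h1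
  simp only [coe_eval₂Hom, RingHom.comp_apply] at h2
  rw [h2, Ideal.Quotient.eq_zero_iff_mem.mpr (hIM hf), map_zero]

namespace ProjectiveVariety

/-- The ideal of the affine chart `x i = 1` of `W`. -/
noncomputable def chartIdeal {k : Type*} [Field k] {n : ℕ} (W : ProjectiveVariety k n) (i : Fin (n + 1)) :
    Ideal (MvPolynomial (Fin (n + 1)) k) :=
  Ideal.span (W.equations ∪ {X i - 1})

theorem forall_mem_chartIdeal_iff {k K : Type*} [Field k] [Field K] {n : ℕ}
    (W : ProjectiveVariety k n) (i : Fin (n + 1)) (σ : k →+* K) (x : Fin (n + 1) → K) :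
    (∀ f ∈ W.chartIdeal i, eval₂ σ x f = 0) ↔ W.VanishesAt σ x ∧ x i = 1 := by
  have : (∀ f ∈ W.chartIdeal i, eval₂ σ x f = 0) ↔
      W.chartIdeal i ≤ RingHom.ker (eval₂Hom σ x) := Iff.rfl
  rw [this, chartIdeal, Ideal.span_le, Set.union_subset_iff, Set.singleton_subset_iff]
  refine and_congr Iff.rfl ?_
  rw [SetLike.mem_coe, RingHom.mem_ker, map_sub, map_one, coe_eval₂Hom, eval₂_X, sub_eq_zero]

namespace Morphism

variable {k K : Type*} [Field k] [Field K] {n m : ℕ} {W : ProjectiveVariety k n}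
  {V : ProjectiveVariety k m}

/-- The ideal of the fibre product of the affine chart `x i = 1` of `W` with itself over `V`. -/
noncomputable def fiberIdeal (π : W.Morphism V) (i : Fin (n + 1)) :
    Ideal (MvPolynomial (Fin (n + 1) ⊕ Fin (n + 1)) k) :=
  (W.chartIdeal i).map (rename Sum.inl) ⊔ (W.chartIdeal i).map (rename Sum.inr) ⊔
    Ideal.span {E | ∃ F ∈ π.reps, ∃ G ∈ π.reps, ∃ a b, E =
      rename Sum.inl (F a) * rename Sum.inr (G b) - rename Sum.inl (F b) * rename Sum.inr (G a)}

theorem forall_mem_fiberIdeal_iff (π : W.Morphism V) (i : Fin (n + 1)) (σ : k →+* K)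
    (x y : Fin (n + 1) → K) :
    (∀ f ∈ π.fiberIdeal i, eval₂ σ (Sum.elim x y) f = 0) ↔
      (W.VanishesAt σ x ∧ x i = 1) ∧ (W.VanishesAt σ y ∧ y i = 1) ∧
        ∀ F ∈ π.reps, ∀ G ∈ π.reps, ∀ a b,
          eval₂ σ x (F a) * eval₂ σ y (G b) = eval₂ σ x (F b) * eval₂ σ y (G a) := by
  have : (∀ f ∈ π.fiberIdeal i, eval₂ σ (Sum.elim x y) f = 0) ↔
      π.fiberIdeal i ≤ RingHom.ker (eval₂Hom σ (Sum.elim x y)) := Iff.rfl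
  rw [this, fiberIdeal, sup_le_iff, sup_le_iff, and_assoc, ← forall_mem_chartIdeal_iff,
    ← forall_mem_chartIdeal_iff, Ideal.map_le_iff_le_comap, Ideal.map_le_iff_le_comap, Ideal.span_le]
  refine and_congr ?_ (and_congr ?_ ?_)
  · refine forall₂_congr fun f _ => ?_
    rw [Ideal.mem_comap, RingHom.mem_ker, coe_eval₂Hom, eval₂_rename, Sum.elim_comp_inl]
  · refine forall₂_congr fun f _ => ?_
    rw [Ideal.mem_comap, RingHom.mem_ker, coe_eval₂Hom, eval₂_rename, Sum.elim_comp_inr]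
  · constructor
    · intro h F hF G hG a b
      have := h ⟨F, hF, G, hG, a, b, rfl⟩
      simpa [eval₂_rename, sub_eq_zero] using this
    · rintro h E ⟨F, hF, G, hG, a, b, rfl⟩
      simpa [eval₂_rename, sub_eq_zero] using h F hF G hG a b

/-- Points satisfying the equations of the fibre product have the same image. -/
theorem map_eq_map_of_mul_eq (π : W.Morphism V) (σ : k →+* K) {x y : Fin (n + 1) → K} (hx : x ≠ 0)
    (hy : y ≠ 0) (hWx : W.VanishesAt σ x) (hWy : W.VanishesAt σ y)
    (h : ∀ F ∈ π.reps, ∀ G ∈ π.reps, ∀ a b,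
      eval₂ σ x (F a) * eval₂ σ y (G b) = eval₂ σ x (F b) * eval₂ σ y (G a)) :
    π.map σ ⟨Projectivization.mk K x hx, (W.mk_mem_points σ x hx).mpr hWx⟩ =
      π.map σ ⟨Projectivization.mk K y hy, (W.mk_mem_points σ y hy).mpr hWy⟩ := by
  obtain ⟨F, hF, hFx⟩ := π.exists_rep σ x hx hWx
  obtain ⟨G, hG, hGy⟩ := π.exists_rep σ y hy hWy
  apply Subtype.ext
  rw [π.map_eq_mk σ _ x hx rfl F hF hFx, π.map_eq_mk σ _ y hy rfl G hG hGy,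
    Projectivization.mk_eq_mk_iff']
  obtain ⟨b, hb⟩ := Function.ne_iff.mp hGy
  have hb' : eval₂ σ y (G b) ≠ 0 := hb
  refine ⟨eval₂ σ x (F b) / eval₂ σ y (G b), funext fun a => ?_⟩
  simp only [Pi.smul_apply, smul_eq_mul]
  rw [div_mul_eq_mul_div, div_eq_iff hb', h F hF G hG a b]

/-- If `π` is locally injective on complex points, then the diagonal is a neighbourhood of each of
its points in the fibre product of a chart with itself. -/
theorem exists_eq_of_near (π : W.Morphism V) (φ : k →+* ℂ) (hπ : IsLocallyInjective (π.map φ))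
    (i : Fin (n + 1)) (w : Fin (n + 1) → ℂ) (hw : W.VanishesAt φ w) (hwi : w i = 1) :
    ∃ ε > 0, ∀ x y : Fin (n + 1) → ℂ, (∀ j, ‖x j - w j‖ < ε) → (∀ j, ‖y j - w j‖ < ε) →
      (∀ f ∈ π.fiberIdeal i, eval₂ φ (Sum.elim x y) f = 0) → x = y := by
  have hne : ∀ x : Fin (n + 1) → ℂ, x i = 1 → x ≠ 0 := by
    rintro x hx rfl
    exact zero_ne_one hx
  let κ : {x : Fin (n + 1) → ℂ // x ≠ 0 ∧ W.VanishesAt φ x} → W.points φ := fun x =>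
    ⟨Projectivization.mk ℂ x.1 x.2.1, (W.mk_mem_points φ x.1 x.2.1).mpr x.2.2⟩
  have hκ : Continuous κ := by
    refine Continuous.subtype_mk ?_ _
    have h1 : Continuous (fun v : {v : Fin (n + 1) → ℂ // v ≠ 0} => Projectivization.mk' ℂ v) :=
      continuous_coinduced_rng
    exact h1.comp (Continuous.subtype_mk continuous_subtype_val fun x => x.2.1)
  obtain ⟨U, hU, hwU, hinj⟩ := hπ (κ ⟨w, hne w hwi, hw⟩)
  obtain ⟨ε, hε, hball⟩ := Metric.isOpen_iff.mp (hU.preimage hκ) ⟨w, hne w hwi, hw⟩ hwU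
  have hmem : ∀ (x : Fin (n + 1) → ℂ) (hx : x ≠ 0 ∧ W.VanishesAt φ x),
      (∀ j, ‖x j - w j‖ < ε) → κ ⟨x, hx⟩ ∈ U := by
    intro x hx hxw
    apply hball
    rw [Metric.mem_ball, Subtype.dist_eq, dist_eq_norm, pi_norm_lt_iff hε]
    exact hxw
  refine ⟨ε, hε, fun x y hx hy hxy => ?_⟩
  obtain ⟨⟨hWx, hxi⟩, ⟨hWy, hyi⟩, hrel⟩ := (π.forall_mem_fiberIdeal_iff i φ x y).mp hxy
  have heq := hinj (hmem x ⟨hne x hxi, hWx⟩ hx) (hmem y ⟨hne y hyi, hWy⟩ hy)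
    (π.map_eq_map_of_mul_eq φ (hne x hxi) (hne y hyi) hWx hWy hrel)
  obtain ⟨a, ha⟩ := (Projectivization.mk_eq_mk_iff' ℂ _ _ (hne x hxi) (hne y hyi)).mp
    (congrArg Subtype.val heq)
  have ha1 := congrFun ha i
  rw [Pi.smul_apply, hyi, hxi, smul_eq_mul, mul_one] at ha1
  rw [← ha, ha1, one_smul]

/-- If `π` is locally injective on complex points, then in each chart a polynomial separates the
diagonal of the fibre product from its complement. -/
theorem exists_separating_polynomial [Infinite k] (π : W.Morphism V) (φ : k →+* ℂ)
    (hπ : IsLocallyInjective (π.map φ)) (i : Fin (n + 1)) :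
    ∃ f : MvPolynomial (Fin (n + 1) ⊕ Fin (n + 1)) k,
      (∀ j, ∃ N : ℕ, (X (Sum.inl j) - X (Sum.inr j)) ^ N * f ∈ π.fiberIdeal i) ∧
        rename (Sum.elim id id) f - 1 ∈ W.chartIdeal i := by
  -- The polynomials that, up to nilpotents, vanish on the fibre product away from the diagonal.
  let 𝔞 : Ideal (MvPolynomial (Fin (n + 1) ⊕ Fin (n + 1)) k) :=
    { carrier := {f | ∀ j, ∃ N : ℕ, (X (Sum.inl j) - X (Sum.inr j)) ^ N * f ∈ π.fiberIdeal i}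
      zero_mem' := fun j => ⟨0, by simp⟩
      add_mem' := by
        intro f g hf hg j
        obtain ⟨N, hN⟩ := hf j
        obtain ⟨M, hM⟩ := hg j
        refine ⟨N + M, ?_⟩
        rw [mul_add]
        refine add_mem ?_ ?_
        · rw [pow_add, mul_right_comm]
          exact Ideal.mul_mem_right _ _ hN
        · rw [pow_add, mul_assoc]
          exact Ideal.mul_mem_left _ _ hM
      smul_mem' := by
        intro c f hf j
        obtain ⟨N, hN⟩ := hf j
        refine ⟨N, ?_⟩
        rw [smul_eq_mul, mul_left_comm]
        exact Ideal.mul_mem_left _ _ hN }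
  let δ : MvPolynomial (Fin (n + 1) ⊕ Fin (n + 1)) k →ₐ[k] MvPolynomial (Fin (n + 1)) k :=
    rename (Sum.elim id id)
  have hδ : Function.Surjective δ := rename_surjective _ fun j => ⟨Sum.inl j, rfl⟩
  -- Otherwise some complex point `w` of the chart kills the restriction of `𝔞` to the diagonal,
  -- while local injectivity at `w` provides an element of `𝔞` that is non-zero at `(w, w)`.
  have htop : W.chartIdeal i ⊔ 𝔞.map δ = ⊤ := by
    by_contra hne
    obtain ⟨w, hw⟩ := exists_zero_of_ne_top φ hne
    obtain ⟨hWw, hwi⟩ := (W.forall_mem_chartIdeal_iff i φ w).mp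
      fun f hf => hw f (Ideal.mem_sup_left hf)
    obtain ⟨ε, hε, hnear⟩ := π.exists_eq_of_near φ hπ i w hWw hwi
    obtain ⟨f, hfw, hf⟩ := exists_pow_mul_mem_of_eventually φ (π.fiberIdeal i)
      (fun j => X (Sum.inl j) - X (Sum.inr j)) (Sum.elim w w) hε (by
        intro v hv hvI j
        have hvs : v = Sum.elim (v ∘ Sum.inl) (v ∘ Sum.inr) := (Sum.elim_comp_inl_inr v).symm
        have := hnear (v ∘ Sum.inl) (v ∘ Sum.inr) (fun j => hv (Sum.inl j))
          (fun j => hv (Sum.inr j)) (by rwa [← hvs])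
        rw [eval₂_sub, eval₂_X, eval₂_X, sub_eq_zero]
        exact congrFun this j)
    apply hfw
    have := hw (δ f) (Ideal.mem_sup_right (Ideal.mem_map_of_mem δ (show f ∈ 𝔞 from hf)))
    rw [eval₂_rename] at this
    rw [← this]
    congr 1
    ext (j | j) <;> rfl
  obtain ⟨e, he, g, hg, heg⟩ := Submodule.mem_sup.mp ((Ideal.eq_top_iff_one _).mp htop)
  obtain ⟨f, hf, rfl⟩ := (Ideal.mem_map_iff_of_surjective δ hδ).mp hg
  refine ⟨f, hf, ?_⟩
  have : rename (Sum.elim id id) f - 1 = -e := by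
    rw [← heg]
    change δ f - (e + δ f) = -e
    ring
  rw [this]
  exact neg_mem he

end Morphism

end ProjectiveVariety

/-! ### Specialisation to algebraic points. -/

namespace ProjectiveVariety

namespace Morphism

/-- The pair of a point of a chart of `W` and its conjugate over the field of definition of its
image lies on the fibre product. -/
theorem eval₂_fiberIdeal_conj {k E F L : Type*} [Field k] [Field E] [Field F] [Field L]
    [Algebra k E] [Algebra k F] [Algebra E F] [IsScalarTower k E F] [Algebra F L] [Algebra E L]
    [Algebra k L] [IsScalarTower E F L] [IsScalarTower k F L] [IsScalarTower k E L] {n m : ℕ}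
    {W : ProjectiveVariety k n} {V : ProjectiveVariety k m} (π : W.Morphism V) {i : Fin (n + 1)}
    {x : Fin (n + 1) → F} (hxi : x i = 1) (hW : W.VanishesAt (algebraMap k F) x)
    (hE : ∀ T ∈ π.reps, ∀ a b, eval₂ (algebraMap k F) x (T b) ≠ 0 →
      ∃ e : E, algebraMap E F e = eval₂ (algebraMap k F) x (T a) / eval₂ (algebraMap k F) x (T b))
    (σ : L →ₐ[E] L) {f : MvPolynomial (Fin (n + 1) ⊕ Fin (n + 1)) k} (hf : f ∈ π.fiberIdeal i) :
    eval₂ (algebraMap k L)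
      (Sum.elim (fun j => algebraMap F L (x j)) (fun j => σ (algebraMap F L (x j)))) f = 0 := by
  have h1 : ∀ T : MvPolynomial (Fin (n + 1)) k,
      eval₂ (algebraMap k L) (fun j => algebraMap F L (x j)) T =
        algebraMap F L (eval₂ (algebraMap k F) x T) := by
    intro T
    rw [hom_eval₂, ← IsScalarTower.algebraMap_eq]
  have h2 : ∀ T : MvPolynomial (Fin (n + 1)) k,
      eval₂ (algebraMap k L) (fun j => σ (algebraMap F L (x j))) T =
        σ (algebraMap F L (eval₂ (algebraMap k F) x T)) := by
    intro T
    rw [← h1, ← RingHom.coe_coe σ, hom_eval₂]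
    have : (σ : L →+* L).comp (algebraMap k L) = algebraMap k L :=
      (σ.restrictScalars k).comp_algebraMap
    rw [this]
  have hx0 : x ≠ 0 := by
    rintro rfl
    exact zero_ne_one hxi
  refine (π.forall_mem_fiberIdeal_iff i (algebraMap k L) _ _).mpr
    ⟨⟨fun T hT => ?_, by simp [hxi]⟩, ⟨fun T hT => ?_, by simp [hxi]⟩, ?_⟩ f hf
  · rw [h1, hW T hT, map_zero]
  · rw [h2, hW T hT, map_zero, map_zero]
  · intro T hT G hG a b
    simp only [h1, h2]
    by_cases hG0 : ∀ c, eval₂ (algebraMap k F) x (G c) = 0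
    · simp [hG0]
    push Not at hG0
    obtain ⟨c, hc⟩ := hG0
    -- the coordinates of `π x` are `σ`-invariant up to a common factor
    have hGσ : ∀ d, σ (algebraMap F L (eval₂ (algebraMap k F) x (G d))) =
        algebraMap F L (eval₂ (algebraMap k F) x (G d)) *
          (σ (algebraMap F L (eval₂ (algebraMap k F) x (G c))) /
            algebraMap F L (eval₂ (algebraMap k F) x (G c))) := by
      intro d
      obtain ⟨e, he⟩ := hE G hG d c hc
      rw [eq_div_iff hc] at he
      have hc' : algebraMap F L (eval₂ (algebraMap k F) x (G c)) ≠ 0 := by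
        simpa using hc
      rw [← he, map_mul, map_mul, ← IsScalarTower.algebraMap_apply, σ.commutes]
      field_simp
    rw [hGσ a, hGσ b, ← mul_assoc, ← mul_assoc, ← map_mul, ← map_mul,
      π.compat_of_hom (algebraMap k F) x hx0 hW hT hG a b]

open NumberField IsDedekindDomain in
/-- The field of definition of a point is unramified over the field of definition of its image, at
all primes that do not divide the denominators of the separating polynomials. -/
theorem isUnramifiedIn_of_separating {k E F : Type*} [Field k] [Field E] [Field F]
    [NumberField k] [NumberField E] [NumberField F] [Algebra k E] [Algebra k F] [Algebra E F]
    [IsScalarTower k E F] {n m : ℕ} {W : ProjectiveVariety k n} {V : ProjectiveVariety k m}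
    (π : W.Morphism V) (f : Fin (n + 1) → MvPolynomial (Fin (n + 1) ⊕ Fin (n + 1)) k)
    (hf : ∀ i j, ∃ N : ℕ, (X (Sum.inl j) - X (Sum.inr j)) ^ N * f i ∈ π.fiberIdeal i)
    (hf1 : ∀ i, rename (Sum.elim id id) (f i) - 1 ∈ W.chartIdeal i) (N : Fin (n + 1) → ℤ)
    (g : Fin (n + 1) → MvPolynomial (Fin (n + 1) ⊕ Fin (n + 1)) (𝓞 k))
    (hg : ∀ i, MvPolynomial.map (algebraMap (𝓞 k) k) (g i) = C (N i : k) * f i)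
    {p : ℕ} (hp : p.Prime) (hpN : ∀ i, ¬ (p : ℤ) ∣ N i)
    {x : Fin (n + 1) → F} (hx : x ≠ 0) (hW : W.VanishesAt (algebraMap k F) x)
    (hE : ∀ T ∈ π.reps, ∀ a b, eval₂ (algebraMap k F) x (T b) ≠ 0 →
      ∃ e : E, algebraMap E F e = eval₂ (algebraMap k F) x (T a) / eval₂ (algebraMap k F) x (T b))
    (hgen : ∀ M : IntermediateField E F, (∀ i j, x i / x j ∈ M) → M = ⊤)
    (𝔭 : Ideal (𝓞 E)) [𝔭.IsPrime] (hp𝔭 : (p : 𝓞 E) ∈ 𝔭) : Algebra.IsUnramifiedIn (𝓞 F) 𝔭 := by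
  let L := IntermediateField.normalClosure E F (AlgebraicClosure F)
  have : FiniteDimensional E F := Module.Finite.of_restrictScalars_finite ℚ E F
  have : FiniteDimensional E L := inferInstance
  have : NumberField L := NumberField.of_module_finite E L
  let _ : Algebra k L := ((algebraMap F L).comp (algebraMap k F)).toAlgebra
  have : IsScalarTower k F L := IsScalarTower.of_algebraMap_eq fun _ => rfl
  have : IsScalarTower k E L := IsScalarTower.of_algebraMap_eq fun a => by
    rw [IsScalarTower.algebraMap_apply E F L, ← IsScalarTower.algebraMap_apply k E F]; rfl
  have : Algebra.IsSeparable E L := inferInstance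
  have : IsGalois E L := ⟨⟩
  refine isUnramifiedIn_of_inertia_fixes (L := L) 𝔭 ?_
  intro 𝔔 h𝔔 h𝔔𝔭 σ hσ
  have hp𝔔 : (p : 𝓞 L) ∈ 𝔔 := by
    have := (Ideal.mem_of_liesOver 𝔔 𝔭 (p : 𝓞 E)).mp hp𝔭
    rwa [map_natCast] at this
  let v : HeightOneSpectrum (𝓞 L) := ⟨𝔔, h𝔔, by
    rintro rfl
    rw [Ideal.mem_bot, Nat.cast_eq_zero] at hp𝔔
    exact hp.ne_zero hp𝔔⟩
  -- Dividing by a coordinate of maximal valuation makes all coordinates integral at `𝔔`; the chart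
  -- thus depends on `𝔔`, which is why every chart needs its polynomial.
  obtain ⟨i, -, hi⟩ := Finset.exists_max_image Finset.univ
    (fun j => v.valuation L (algebraMap F L (x j))) Finset.univ_nonempty
  have hxi : x i ≠ 0 := by
    obtain ⟨j, hj⟩ := Function.ne_iff.mp hx
    intro h0
    have := hi j (Finset.mem_univ j)
    rw [h0, map_zero, map_zero, le_zero_iff, map_eq_zero, map_eq_zero] at this
    exact hj this
  set y : Fin (n + 1) → F := (x i)⁻¹ • x with hy
  have hyi : y i = 1 := by simp [hy, hxi]
  have hWy : W.VanishesAt (algebraMap k F) y := hW.smul _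
  have hEy : ∀ T ∈ π.reps, ∀ a b, eval₂ (algebraMap k F) y (T b) ≠ 0 →
      ∃ e : E, algebraMap E F e =
        eval₂ (algebraMap k F) y (T a) / eval₂ (algebraMap k F) y (T b) := by
    intro T hT a b hb
    obtain ⟨d, hd⟩ := π.homogeneous T hT
    rw [hy, eval₂_smul_of_isHomogeneous (hd b)] at hb
    rw [hy, eval₂_smul_of_isHomogeneous (hd b), eval₂_smul_of_isHomogeneous (hd a),
      mul_div_mul_left _ _ (left_ne_zero_of_mul hb)]
    exact hE T hT a b (right_ne_zero_of_mul hb)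
  set z : Fin (n + 1) → L := fun j => algebraMap F L (y j) with hz
  have hvz : ∀ j, v.valuation L (z j) ≤ 1 := by
    intro j
    have hpos : 0 < v.valuation L (algebraMap F L (x i)) := by
      rw [zero_lt_iff, Ne, map_eq_zero, map_eq_zero]; exact hxi
    simp only [hz, hy, Pi.smul_apply, smul_eq_mul, map_mul, map_inv₀]
    rw [inv_mul_le_iff₀ hpos, mul_one]
    exact hi j (Finset.mem_univ j)
  have hfix : ∀ j, σ (z j) = z j := by
    intro j
    by_contra hj
    obtain ⟨M, hM⟩ := hf i j
    have h0 := π.eval₂_fiberIdeal_conj (L := L) hyi hWy hEy (σ : L →ₐ[E] L) hM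
    -- On the fibre product a power of `z j - σ (z j)` times `f i` is zero, and the first factor is
    -- not.
    have hfz : eval₂ (algebraMap k L) (Sum.elim z fun l => σ (z l)) (f i) = 0 := by
      rw [eval₂_mul, eval₂_pow, eval₂_sub, eval₂_X, eval₂_X] at h0
      refine (mul_eq_zero.mp h0).resolve_left (pow_ne_zero _ (sub_ne_zero.mpr ?_))
      exact fun h => hj h.symm
    have hf1z : eval₂ (algebraMap k L) (Sum.elim z z) (f i) = 1 := by
      have hWz : W.VanishesAt (algebraMap k L) z := by
        intro T hT
        have : eval₂ (algebraMap k L) z T = algebraMap F L (eval₂ (algebraMap k F) y T) := by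
          rw [hom_eval₂, ← IsScalarTower.algebraMap_eq]
        rw [this, hWy T hT, map_zero]
      have h1 := (W.forall_mem_chartIdeal_iff i (algebraMap k L) z).mpr
        ⟨hWz, by simp [hz, hyi]⟩ _ (hf1 i)
      rw [eval₂_sub, eval₂_one, sub_eq_zero, eval₂_rename] at h1
      rw [← h1]
      congr 1
      ext (l | l) <;> rfl
    have hgv : ∀ w : Fin (n + 1) ⊕ Fin (n + 1) → L,
        eval₂ ((algebraMap k L).comp (algebraMap (𝓞 k) k)) w (g i) =
          (N i : L) * eval₂ (algebraMap k L) w (f i) := by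
      intro w
      rw [← eval₂_map, hg, eval₂_mul, eval₂_C, map_intCast]
    have hlt := valuation_eval₂_sub_lt_one (v.valuation L)
      ((algebraMap k L).comp (algebraMap (𝓞 k) k)) (fun r => by
        have : IsIntegral ℤ (algebraMap k L (algebraMap (𝓞 k) k r)) :=
          (RingOfIntegers.isIntegral_coe r).map (algebraMap k L).toIntAlgHom
        exact v.valuation_le_one (⟨_, this⟩ : 𝓞 L))
      (a := Sum.elim z z) (b := Sum.elim z fun l => σ (z l))
      (by rintro (l | l) <;> exact hvz l)
      (by
        rintro (l | l)
        · exact hvz l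
        · exact (valuation_inertia v σ hσ (hvz l)).1)
      (by
        rintro (l | l)
        · simp
        · exact (valuation_inertia v σ hσ (hvz l)).2) (g i)
    rw [hgv, hgv, hfz, hf1z, mul_one, mul_zero, sub_zero] at hlt
    have hN𝔔 : ((N i : ℤ) : 𝓞 L) ∈ 𝔔 := by
      refine (v.valuation_lt_one_iff_mem (K := L) _).mp ?_
      exact hlt
    have hcop : IsCoprime (p : ℤ) (N i) :=
      ((Nat.prime_iff_prime_int.mp hp).irreducible.coprime_iff_not_dvd).mpr (hpN i)
    obtain ⟨a, b, hab⟩ := hcop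
    refine h𝔔.ne_top ((Ideal.eq_top_iff_one _).mpr ?_)
    have h1 : (1 : 𝓞 L) = (a : 𝓞 L) * p + (b : 𝓞 L) * (N i : ℤ) := by
      exact_mod_cast congrArg (Int.cast (R := 𝓞 L)) hab.symm
    rw [h1]
    exact add_mem (Ideal.mul_mem_left _ _ hp𝔔) (Ideal.mul_mem_left _ _ hN𝔔)
  -- The subfield of `F` fixed by `σ` contains all coordinate ratios, so it is everything.
  let M : IntermediateField E F :=
    (AlgHom.equalizer ((σ : L →ₐ[E] L).comp (IsScalarTower.toAlgHom E F L))
      (IsScalarTower.toAlgHom E F L)).toIntermediateField fun a ha => by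
        rw [AlgHom.mem_equalizer] at ha ⊢
        rw [map_inv₀, map_inv₀, ha]
  have hM : M = ⊤ := by
    refine hgen M fun a b => ?_
    have hxy : x a / x b = y a / y b := by
      simp only [hy, Pi.smul_apply, smul_eq_mul]
      rw [mul_div_mul_left _ _ (inv_ne_zero hxi)]
    change σ (algebraMap F L (x a / x b)) = algebraMap F L (x a / x b)
    rw [hxy, map_div₀, map_div₀]
    exact congrArg₂ (· / ·) (hfix a) (hfix b)
  intro a
  exact (hM ▸ IntermediateField.mem_top : a ∈ M)

end Morphism

end ProjectiveVariety

/-! ### The exceptional set and the conclusion. -/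

theorem finiteDimensional_fieldOfPoint {k : Type*} [Field k] {n : ℕ}
    (P : ℙ (AlgebraicClosure k) (Fin (n + 1) → AlgebraicClosure k)) :
    FiniteDimensional k (fieldOfPoint P) := by
  have hfin : {z | ∃ i j, P.rep j ≠ 0 ∧ z = P.rep i / P.rep j}.Finite := by
    refine (Set.finite_range fun ij : Fin (n + 1) × Fin (n + 1) =>
      P.rep ij.1 / P.rep ij.2).subset ?_
    rintro z ⟨i, j, -, rfl⟩
    exact ⟨(i, j), rfl⟩
  have := hfin.to_subtype
  exact IntermediateField.finiteDimensional_adjoin fun z _ =>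
    (Algebra.IsAlgebraic.isAlgebraic z).isIntegral

theorem theorem1 {k : Type*} [Field k] [NumberField k] {n m : ℕ}
    (W : ProjectiveVariety k n) (V : ProjectiveVariety k m) (π : W.Morphism V)
    (hdom : π.IsDominant)
    (hcov : ∃ φ : k →+* ℂ, IsTopologicalCover (π.map φ)) :
    ∃ S : Finset RatPlace,
      ∀ (P : V.points (algebraMap k (AlgebraicClosure k)))
        (Q : W.points (algebraMap k (AlgebraicClosure k)))
        (hPQ : π.map (algebraMap k (AlgebraicClosure k)) Q = P),
        IsUnramifiedOutside (S : Set RatPlace) (fieldOfPoint P.1)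
          (IntermediateField.extendScalars
            (show fieldOfPoint P.1 ≤ fieldOfPoint Q.1 from hPQ ▸ π.fieldOfPoint_map_le Q)) := by
  obtain ⟨φ, -, hcov⟩ := hcov
  have hinj : IsLocallyInjective (π.map φ) := hcov.isLocalHomeomorph.isLocallyInjective
  choose f hf hf1 using π.exists_separating_polynomial φ hinj
  choose N g hN hg using fun i => NumberField.exists_map_eq_intCast_mul (f i)
  have hfin : {p : Nat.Primes | ∃ i, ((p : ℕ) : ℤ) ∣ N i}.Finite := by
    rw [Set.ofPred_exists]
    refine Set.finite_iUnion fun i => ?_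
    refine Set.Finite.of_finite_image (f := fun p : Nat.Primes => (p : ℕ)) ?_
      (Subtype.val_injective.injOn)
    refine (Nat.divisors (N i).natAbs).finite_toSet.subset ?_
    rintro _ ⟨p, hp, rfl⟩
    simpa [hN i] using Int.natCast_dvd.mp hp
  classical
  -- With the archimedean place in `S`, the condition on infinite places is vacuous.
  refine ⟨insert none (hfin.toFinset.image some), fun P Q hPQ => ⟨?_, fun h => ?_⟩⟩
  swap
  · exact absurd (by simp) h
  intro p hp 𝔭 h𝔭 hp𝔭
  have hpN : ∀ i, ¬ ((p : ℕ) : ℤ) ∣ N i := by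
    intro i hi
    exact hp (by simpa using ⟨i, hi⟩)
  have hle : fieldOfPoint P.1 ≤ fieldOfPoint Q.1 := hPQ ▸ π.fieldOfPoint_map_le Q
  have := finiteDimensional_fieldOfPoint P.1
  have := finiteDimensional_fieldOfPoint Q.1
  have : NumberField (fieldOfPoint P.1) := NumberField.of_module_finite k _
  have : FiniteDimensional k (IntermediateField.extendScalars hle) :=
    inferInstanceAs (FiniteDimensional k (fieldOfPoint Q.1))
  have : NumberField (IntermediateField.extendScalars hle) := NumberField.of_module_finite k _
  obtain ⟨j₀, hj₀⟩ := Function.ne_iff.mp Q.1.rep_nonzero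
  have hj₀' : Q.1.rep j₀ ≠ 0 := hj₀
  have hmem : ∀ j, (Q.1.rep j₀)⁻¹ * Q.1.rep j ∈ fieldOfPoint Q.1 := fun j =>
    IntermediateField.subset_adjoin k _ ⟨j, j₀, hj₀', by rw [div_eq_inv_mul]⟩
  -- Coordinates of `Q` with the entry `j₀` scaled to `1`, so that they all lie in `k(Q)`.
  let x : Fin (n + 1) → IntermediateField.extendScalars hle := fun j => ⟨_, hmem j⟩
  have hx1 : x j₀ = 1 := Subtype.ext (inv_mul_cancel₀ hj₀')
  have hx0 : x ≠ 0 := fun h => zero_ne_one ((congrFun h j₀).symm.trans hx1)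
  have heval : ∀ T : MvPolynomial (Fin (n + 1)) k,
      ((eval₂ (algebraMap k (IntermediateField.extendScalars hle)) x T :
        IntermediateField.extendScalars hle) : AlgebraicClosure k) =
        eval₂ (algebraMap k (AlgebraicClosure k)) ((Q.1.rep j₀)⁻¹ • Q.1.rep) T := by
    intro T
    exact hom_eval₂ T _ (algebraMap (IntermediateField.extendScalars hle) (AlgebraicClosure k)) x
  have hQ0 : (Q.1.rep j₀)⁻¹ • Q.1.rep ≠ 0 := smul_ne_zero (inv_ne_zero hj₀') Q.1.rep_nonzero
  have hQmk : Q.1 = Projectivization.mk (AlgebraicClosure k) ((Q.1.rep j₀)⁻¹ • Q.1.rep) hQ0 := by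
    conv_lhs => rw [← Q.1.mk_rep]
    rw [Projectivization.mk_eq_mk_iff']
    exact ⟨Q.1.rep j₀, smul_inv_smul₀ hj₀' _⟩
  refine π.isUnramifiedIn_of_separating f hf hf1 N g hg p.2 hpN (x := x) hx0 ?_ ?_ ?_ 𝔭 hp𝔭
  · intro T hT
    apply Subtype.ext
    rw [heval]
    exact (show W.VanishesAt _ _ from Q.2).smul _ T hT
  · intro T hT a b hb
    have hb' : eval₂ (algebraMap k (AlgebraicClosure k)) ((Q.1.rep j₀)⁻¹ • Q.1.rep) (T b) ≠ 0 := by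
      rw [← heval]
      exact fun h => hb (Subtype.ext h)
    have hP := π.map_eq_mk _ Q _ hQ0 hQmk T hT (Function.ne_iff.mpr ⟨b, hb'⟩)
    rw [hPQ] at hP
    -- The values of `T` at `x` are homogeneous coordinates of `P`, so their ratios lie in `k(P)`.
    refine ⟨⟨_, ?_⟩, Subtype.ext (congrArg₂ (· / ·) (heval (T a)) (heval (T b))).symm⟩
    rw [hP, fieldOfPoint_mk]
    exact IntermediateField.subset_adjoin k _ ⟨a, b, hb', rfl⟩
  · intro M hM
    rw [eq_top_iff]
    intro z _
    have hQM : fieldOfPoint Q.1 ≤ (IntermediateField.lift M).restrictScalars k := by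
      refine IntermediateField.adjoin_le_iff.mpr ?_
      rintro _ ⟨a, b, -, rfl⟩
      have h1 : ((x a / x b : IntermediateField.extendScalars hle) : AlgebraicClosure k) =
          Q.1.rep a / Q.1.rep b := mul_div_mul_left _ _ (inv_ne_zero hj₀')
      rw [← h1]
      exact (IntermediateField.mem_lift (x a / x b)).mpr (hM a b)
    exact (IntermediateField.mem_lift z).mp (hQM z.2)
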